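/- Let $k$ be a field. For a coalgebra $C$ over $k$ with comultiplication $\Delta$, a right coideal of $C$ is a subspace $N\subseteq C$ with $\Delta(N)\subseteq N\otimes C$, and a subcoalgebra is a subspace $E\subseteq C$ with $\Delta(E)\subseteq E\otimes E$. The coalgebra $C$ is called a chain coalgebra if any two of its right coideals are comparable with respect to inclusion. Let $C_0$ be the sum of all simple (i.e. minimal non-zero) right coideals of $C$, that is, the socle of $C$ as a right $C$-comodule; it is a subcoalgebra of $C$, so that $C_0^*=\mathrm{Hom}_k(C_0,k)$ is a $k$-algebra under the convolution product. For a finite-dimensional division algebra $D$ over $k$, a chain coalgebra $C$ is said to be of type $D$ if $D\simeq C_0^*$ as $k$-algebras. For a $k$-algebra $A$, the finite dual $A^\circ$ is the coalgebra of all $k$-linear maps $f:A\to k$ that vanish on some two-sided ideal of finite codimension in $A$, with the comultiplication dual to the multiplication of $A$ (if $\Delta(f)=\sum_i f_i\otimes g_i$ then $f(ab)=\sum_i f_i(a)g_i(b)$ for all $a,b\in A$) and the counit $f\mapsto f(1)$. Let $D$ be a finite-dimensional central division algebra over $k$ (i.e. the center of $D$ is $k$), and let $D[[x]]$ be the algebra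 of formal power series in $x$ with coefficients in $D$, where $x$ commutes with the elements of $D$. Then every chain coalgebra over $k$ of type $D$ is isomorphic, as a coalgebra, to a subcoalgebra of $D[[x]]^\circ$. -/

import Mathlib

open scoped TensorProduct

noncomputable section

namespace ChainCoalg

universe u v w

/-! ### Linear algebra of tensor products over a field -/

section LinAlg

variable {k : Type u} [Field k] {V : Type v} [AddCommGroup V] [Module k V]
  {W : Type w} [AddCommGroup W] [Module k W]

/-- A family of functionals separating the points of `V` separates the points of `V ⊗ W`. -/
theorem eq_zero_of_rTensor {ι : Type*} (F : ι → V →ₗ[k] k)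
    (hF : ∀ v, (∀ i, F i v = 0) → v = 0) (t : V ⊗[k] W)
    (ht : ∀ i, (F i).rTensor W t = 0) : t = 0 := by
  classical
  let b := Module.Basis.ofVectorSpace k W
  apply (TensorProduct.equivFinsuppOfBasisRight (M := V) b).injective
  rw [map_zero]
  ext j
  apply hF
  intro i
  have key : ∀ s : V ⊗[k] W, F i (TensorProduct.equivFinsuppOfBasisRight (M := V) b s j) =
      b.coord j (TensorProduct.lid k W ((F i).rTensor W s)) := by
    intro s
    induction s with
    | zero => simp
    | tmul x y => simp [mul_comm]
    | add x y hx hy => simp only [map_add, Finsupp.add_apply, hx, hy]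
  rw [key, ht]
  simp

theorem eq_zero_of_lTensor {ι : Type*} (F : ι → W →ₗ[k] k)
    (hF : ∀ v, (∀ i, F i v = 0) → v = 0) (t : V ⊗[k] W)
    (ht : ∀ i, (F i).lTensor V t = 0) : t = 0 := by
  apply (TensorProduct.comm k V W).injective
  rw [map_zero]
  refine eq_zero_of_rTensor F hF _ fun i => ?_
  have key : ∀ s : V ⊗[k] W, (F i).rTensor V (TensorProduct.comm k V W s) =
      TensorProduct.comm k V k ((F i).lTensor V s) := by
    intro s
    induction s with
    | zero => simp
    | tmul x y => simp
    | add x y hx hy => simp only [map_add, hx, hy]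
  rw [key, ht, map_zero]

theorem eq_of_all_dual (x : V) (hx : ∀ f : V →ₗ[k] k, f x = 0) : x = 0 :=
  (Module.forall_dual_apply_eq_zero_iff k x).1 hx

theorem exists_projection (N : Submodule k V) :
    ∃ p : V →ₗ[k] N, p ∘ₗ N.subtype = LinearMap.id :=
  N.subtype.exists_leftInverse_of_injective N.ker_subtype

end LinAlg

/-! ### Subcoalgebras -/

/-- A subcoalgebra of `C`: a subspace `E` with `Δ(E) ⊆ E ⊗ E`. -/
structure Subcoalgebra (k : Type u) [Field k] (C : Type v) [AddCommGroup C] [Module k C]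
    [Coalgebra k C] where
  carrier : Submodule k C
  comul_mem : ∀ x ∈ carrier, Coalgebra.comul (R := k) x ∈
    LinearMap.range (TensorProduct.map carrier.subtype carrier.subtype)

namespace Subcoalgebra

variable {k : Type u} [Field k] {C : Type v} [AddCommGroup C] [Module k C] [Coalgebra k C]

instance : CoeSort (Subcoalgebra k C) (Type v) := ⟨fun E => ↥E.carrier⟩

variable (E : Subcoalgebra k C)

theorem map_subtype_injective :
    Function.Injective (TensorProduct.map E.carrier.subtype E.carrier.subtype) :=
  TensorProduct.map_injective_of_flat_flat _ _ E.carrier.injective_subtype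
    E.carrier.injective_subtype

/-- The restriction of `Δ` to `E`, as a map `E → E ⊗ E`. -/
def comul : E →ₗ[k] E ⊗[k] E :=
  LinearMap.codRestrictOfInjective (Coalgebra.comul ∘ₗ E.carrier.subtype)
    (TensorProduct.map E.carrier.subtype E.carrier.subtype) E.map_subtype_injective
    (fun x => E.comul_mem x x.2)

theorem map_comul (x : E) : TensorProduct.map E.carrier.subtype E.carrier.subtype (E.comul x) =
    Coalgebra.comul (R := k) (x : C) :=
  LinearMap.codRestrictOfInjective_comp_apply _ _ _ _ x

/-- The coalgebra structure of a subcoalgebra is the restriction of that of `C`. -/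
instance : Coalgebra k E.carrier where
  comul := E.comul
  counit := Coalgebra.counit ∘ₗ E.carrier.subtype
  coassoc := by
    ext x
    apply TensorProduct.map_injective_of_flat_flat E.carrier.subtype
      (TensorProduct.map E.carrier.subtype E.carrier.subtype)
      E.carrier.injective_subtype E.map_subtype_injective
    have h1 : ∀ t : E ⊗[k] E,
        TensorProduct.map E.carrier.subtype (TensorProduct.map E.carrier.subtype E.carrier.subtype)
          (TensorProduct.assoc k E E E (E.comul.rTensor E t)) =
        TensorProduct.assoc k C C C ((Coalgebra.comul (R := k)).rTensor C
          (TensorProduct.map E.carrier.subtype E.carrier.subtype t)) := by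
      intro t
      induction t with
      | zero => simp
      | add x y hx hy => simp only [map_add, hx, hy]
      | tmul x y =>
        simp only [LinearMap.rTensor_tmul, TensorProduct.map_tmul, Submodule.subtype_apply]
        rw [← E.map_comul]
        generalize E.comul x = s
        induction s with
        | zero => simp
        | tmul a b => simp
        | add a b ha hb => simp only [map_add, TensorProduct.add_tmul, ha, hb]
    have h2 : ∀ t : E ⊗[k] E,
        TensorProduct.map E.carrier.subtype (TensorProduct.map E.carrier.subtype E.carrier.subtype)
          (E.comul.lTensor E t) =
        (Coalgebra.comul (R := k)).lTensor C
          (TensorProduct.map E.carrier.subtype E.carrier.subtype t) := by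
      intro t
      induction t with
      | zero => simp
      | add x y hx hy => simp only [map_add, hx, hy]
      | tmul x y =>
        simp only [LinearMap.lTensor_tmul, TensorProduct.map_tmul, Submodule.subtype_apply]
        rw [← E.map_comul]
    simp only [LinearMap.comp_apply, LinearEquiv.coe_coe]
    rw [h1, h2, E.map_comul, Coalgebra.coassoc_apply]
  rTensor_counit_comp_comul := by
    ext x
    have h : ∀ t : E ⊗[k] E, E.carrier.subtype.lTensor k
        ((Coalgebra.counit ∘ₗ E.carrier.subtype).rTensor E t) =
        (Coalgebra.counit (R := k)).rTensor C
          (TensorProduct.map E.carrier.subtype E.carrier.subtype t) := by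
      intro t
      induction t with
      | zero => simp
      | tmul a b => simp
      | add a b ha hb => simp only [map_add, ha, hb]
    apply Module.Flat.lTensor_preserves_injective_linearMap (M := k) E.carrier.subtype
      E.carrier.injective_subtype
    simp only [LinearMap.comp_apply]
    rw [h, E.map_comul, Coalgebra.rTensor_counit_comul]
    simp
  lTensor_counit_comp_comul := by
    ext x
    have h : ∀ t : E ⊗[k] E, E.carrier.subtype.rTensor k
        ((Coalgebra.counit ∘ₗ E.carrier.subtype).lTensor E t) =
        (Coalgebra.counit (R := k)).lTensor C
          (TensorProduct.map E.carrier.subtype E.carrier.subtype t) := by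
      intro t
      induction t with
      | zero => simp
      | tmul a b => simp
      | add a b ha hb => simp only [map_add, ha, hb]
    apply Module.Flat.rTensor_preserves_injective_linearMap (M := k) E.carrier.subtype
      E.carrier.injective_subtype
    simp only [LinearMap.comp_apply]
    rw [h, E.map_comul, Coalgebra.lTensor_counit_comul]
    simp

end Subcoalgebra

/-! ### Right coideals, chain coalgebras, and the coradical -/

section Coideals

variable {k : Type u} [Field k] {C : Type v} [AddCommGroup C] [Module k C] [Coalgebra k C]

/-- A right coideal of `C`, that is, a right subcomodule of `C`: a subspace `N` with
`Δ(N) ⊆ N ⊗ C`. -/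
def IsRightCoideal (N : Submodule k C) : Prop :=
  ∀ x ∈ N, Coalgebra.comul (R := k) x ∈ LinearMap.range (N.subtype.rTensor C)

/-- A simple right coideal: nonzero, and with no right coideals in it but zero and itself. -/
def IsSimpleRightCoideal (N : Submodule k C) : Prop :=
  IsRightCoideal N ∧ N ≠ ⊥ ∧ ∀ M : Submodule k C, IsRightCoideal M → M ≤ N → M = ⊥ ∨ M = N

/-- The left action `f ⇀ c = (id ⊗ f)(Δ c)` of the dual algebra `C^*` on `C`. -/
def leftHit (f : C →ₗ[k] k) : C →ₗ[k] C :=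
  (TensorProduct.rid k C).toLinearMap ∘ₗ f.lTensor C ∘ₗ Coalgebra.comul

/-- The right action `c ↼ g = (g ⊗ id)(Δ c)` of the dual algebra `C^*` on `C`. -/
def rightHit (g : C →ₗ[k] k) : C →ₗ[k] C :=
  (TensorProduct.lid k C).toLinearMap ∘ₗ g.rTensor C ∘ₗ Coalgebra.comul

theorem leftHit_rightHit (f g : C →ₗ[k] k) (c : C) :
    leftHit f (rightHit g c) = rightHit g (leftHit f c) := by
  have h1 : ∀ t : C ⊗[k] C, leftHit f (TensorProduct.lid k C (g.rTensor C t)) =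
      TensorProduct.rid k C (TensorProduct.lid k (C ⊗[k] k) (g.rTensor _ ((f.lTensor C).lTensor C
        ((Coalgebra.comul (R := k)).lTensor C t)))) := by
    intro t
    induction t with
    | zero => simp
    | add a b ha hb => simp only [map_add, ha, hb]
    | tmul a b => simp [leftHit]
  have h2 : ∀ t : C ⊗[k] C, rightHit g (TensorProduct.rid k C (f.lTensor C t)) =
      TensorProduct.rid k C (TensorProduct.lid k (C ⊗[k] k) (g.rTensor _ ((f.lTensor C).lTensor C
        (TensorProduct.assoc k C C C ((Coalgebra.comul (R := k)).rTensor C t))))) := by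
    intro t
    induction t with
    | zero => simp
    | add a b ha hb => simp only [map_add, ha, hb]
    | tmul a b =>
      simp only [rightHit, LinearMap.comp_apply, LinearMap.lTensor_tmul, TensorProduct.rid_tmul,
        map_smul, LinearMap.rTensor_tmul, LinearEquiv.coe_coe]
      generalize (Coalgebra.comul (R := k) a) = s
      induction s with
      | zero => simp
      | tmul x y => simp [smul_smul, mul_comm]
      | add x y hx hy => simp only [map_add, TensorProduct.add_tmul, smul_add, hx, hy]
  have e1 : leftHit f (rightHit g c) = _ := h1 (Coalgebra.comul c)
  have e2 : rightHit g (leftHit f c) = _ := h2 (Coalgebra.comul c)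
  rw [e1, e2, Coalgebra.coassoc_apply]

/-- Right coideals are the same as left `C^*`-submodules of `C`. -/
theorem isRightCoideal_iff (N : Submodule k C) :
    IsRightCoideal N ↔ ∀ f : C →ₗ[k] k, ∀ x ∈ N, leftHit f x ∈ N := by
  constructor
  · intro h f x hx
    obtain ⟨t, ht⟩ := h x hx
    have : leftHit f x = N.subtype (TensorProduct.rid k N (f.lTensor N t)) := by
      simp only [leftHit, LinearMap.comp_apply, ← ht, LinearEquiv.coe_coe]
      generalize t = s
      induction s with
      | zero => simp
      | tmul a b => simp
      | add a b ha hb => simp only [map_add, ha, hb]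
    rw [this]
    exact Subtype.property _
  · intro h x hx
    obtain ⟨p, hp⟩ := exists_projection N
    refine ⟨p.rTensor C (Coalgebra.comul x), ?_⟩
    rw [← sub_eq_zero]
    refine eq_zero_of_lTensor (fun f : C →ₗ[k] k => f) eq_of_all_dual _ fun f => ?_
    apply (TensorProduct.rid k C).injective
    have key : ∀ t : C ⊗[k] C, TensorProduct.rid k C (f.lTensor C
        (N.subtype.rTensor C (p.rTensor C t))) = p (TensorProduct.rid k C (f.lTensor C t)) := by
      intro t
      induction t with
      | zero => simp
      | tmul a b => simp
      | add a b ha hb => simp only [map_add, ha, hb, Submodule.coe_add]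
    rw [map_sub, map_sub, map_zero, key, sub_eq_zero]
    have := LinearMap.congr_fun hp ⟨_, h f x hx⟩
    exact congrArg Subtype.val this

theorem exists_eq_of_rightHit (N : Submodule k C)
    (h : ∀ g : C →ₗ[k] k, ∀ x ∈ N, rightHit g x ∈ N) (p : C →ₗ[k] N)
    (hp : p ∘ₗ N.subtype = LinearMap.id) (x : C) (hx : x ∈ N) :
    N.subtype.lTensor C (p.lTensor C (Coalgebra.comul (R := k) x)) = Coalgebra.comul (R := k) x := by
  rw [← sub_eq_zero]
  refine eq_zero_of_rTensor (fun f : C →ₗ[k] k => f) eq_of_all_dual _ fun f => ?_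
  apply (TensorProduct.lid k C).injective
  have key : ∀ t : C ⊗[k] C, TensorProduct.lid k C (f.rTensor C
      (N.subtype.lTensor C (p.lTensor C t))) = p (TensorProduct.lid k C (f.rTensor C t)) := by
    intro t
    induction t with
    | zero => simp
    | tmul a b => simp
    | add a b ha hb => simp only [map_add, ha, hb, Submodule.coe_add]
  rw [map_sub, map_sub, map_zero, key, sub_eq_zero]
  exact congrArg Subtype.val (LinearMap.congr_fun hp ⟨_, h f x hx⟩)

/-- A subspace that is stable under both actions of `C^*` is a subcoalgebra. -/
theorem comul_mem_of_hit (N : Submodule k C) (hN : IsRightCoideal N)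
    (h : ∀ g : C →ₗ[k] k, ∀ x ∈ N, rightHit g x ∈ N) (x : C) (hx : x ∈ N) :
    Coalgebra.comul (R := k) x ∈ LinearMap.range (TensorProduct.map N.subtype N.subtype) := by
  obtain ⟨p, hp⟩ := exists_projection N
  obtain ⟨t, ht⟩ := hN x hx
  refine ⟨p.lTensor N t, ?_⟩
  have h1 := exists_eq_of_rightHit N h p hp x hx
  rw [← ht] at h1 ⊢
  rw [← h1]
  generalize t = s
  induction s with
  | zero => simp
  | tmul a b => simp
  | add a b ha hb => simp only [map_add, ha, hb]

theorem isRightCoideal_map_rightHit (g : C →ₗ[k] k) (N : Submodule k C) (hN : IsRightCoideal N) :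
    IsRightCoideal (N.map (rightHit g)) := by
  rw [isRightCoideal_iff] at hN ⊢
  rintro f _ ⟨x, hx, rfl⟩
  rw [leftHit_rightHit]
  exact ⟨_, hN f x hx, rfl⟩

theorem isSimpleRightCoideal_map_rightHit (g : C →ₗ[k] k) (N : Submodule k C)
    (hN : IsSimpleRightCoideal N) (h0 : N.map (rightHit g) ≠ ⊥) :
    IsSimpleRightCoideal (N.map (rightHit g)) := by
  refine ⟨isRightCoideal_map_rightHit g N hN.1, h0, fun M hM hMN => ?_⟩
  have h1 : IsRightCoideal (N ⊓ M.comap (rightHit g)) := by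
    have hN' := (isRightCoideal_iff N).1 hN.1
    rw [isRightCoideal_iff] at hM ⊢
    rintro f x ⟨hx, hxM⟩
    refine ⟨hN' f x hx, ?_⟩
    change rightHit g (leftHit f x) ∈ M
    rw [← leftHit_rightHit]
    exact hM f _ hxM
  rcases hN.2.2 _ h1 inf_le_left with h | h
  · left
    rw [eq_bot_iff]
    intro y hy
    obtain ⟨x, hx, rfl⟩ := hMN hy
    have : x ∈ N ⊓ M.comap (rightHit g) := ⟨hx, hy⟩
    rw [h, Submodule.mem_bot] at this
    simp [this]
  · right
    refine le_antisymm hMN ?_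
    rw [Submodule.map_le_iff_le_comap]
    exact inf_eq_left.1 h

variable (k C)

/-- The socle of `C` as a right comodule (equivalently, as a left `C^*`-module): the sum of the
simple right coideals. -/
def socle : Submodule k C := sSup {N | IsSimpleRightCoideal N}

theorem isRightCoideal_socle : IsRightCoideal (socle k C) := by
  rw [isRightCoideal_iff]
  intro f
  change socle k C ≤ (socle k C).comap (leftHit f)
  refine sSup_le fun N hN x hx => ?_
  exact (le_sSup hN : N ≤ socle k C) ((isRightCoideal_iff N).1 hN.1 f x hx)

theorem rightHit_socle (g : C →ₗ[k] k) : ∀ x ∈ socle k C, rightHit g x ∈ socle k C := by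
  change socle k C ≤ (socle k C).comap (rightHit g)
  refine sSup_le fun N hN => ?_
  rw [← Submodule.map_le_iff_le_comap]
  by_cases h0 : N.map (rightHit g) = ⊥
  · rw [h0]; exact bot_le
  · exact le_sSup (isSimpleRightCoideal_map_rightHit g N hN h0)

/-- The coradical `C₀` of `C`: the socle, with its structure of a subcoalgebra. -/
def coradical : Subcoalgebra k C where
  carrier := socle k C
  comul_mem := comul_mem_of_hit _ (isRightCoideal_socle k C) (rightHit_socle k C)

/-- A chain coalgebra: any two right coideals are comparable, so that the lattice of right coideals
is a chain. -/
def IsChainCoalgebra : Prop :=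
  ∀ M N : Submodule k C, IsRightCoideal M → IsRightCoideal N → M ≤ N ∨ N ≤ M

/-- A chain coalgebra of type `D`: a chain coalgebra such that `D ≃ (C₀)^*` as `k`-algebras, where
`(C₀)^*` has the convolution product. -/
def IsChainCoalgebraOfType (D : Type w) [DivisionRing D] [Algebra k D] : Prop :=
  IsChainCoalgebra k C ∧ Nonempty (D ≃ₐ[k] WithConv (coradical k C →ₗ[k] k))

end Coideals

/-! ### The finite dual of an algebra -/

section FiniteDual

variable (k : Type u) [Field k] (A : Type v) [Ring A] [Algebra k A]

/-- The subspace of the functionals on `A` that vanish on some two-sided ideal of finite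
codimension. -/
def finiteDualSubmodule : Submodule k (A →ₗ[k] k) where
  carrier := {f | ∃ I : Ideal A, I.IsTwoSided ∧ FiniteDimensional k (A ⧸ I) ∧ ∀ a ∈ I, f a = 0}
  zero_mem' := ⟨⊤, inferInstance, inferInstance, fun _ _ => rfl⟩
  add_mem' := by
    rintro f g ⟨I, hI, hIf, hfI⟩ ⟨J, hJ, hJf, hgJ⟩
    refine ⟨I ⊓ J, ⟨fun b ha => ⟨I.mul_mem_right b ha.1, J.mul_mem_right b ha.2⟩⟩, ?_, fun a ha => ?_⟩
    · let φ : (A ⧸ (I ⊓ J)) →ₗ[k] (A ⧸ I) × (A ⧸ J) :=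
        ((Submodule.factor (inf_le_left : I ⊓ J ≤ I)).prod
          (Submodule.factor (inf_le_right : I ⊓ J ≤ J))).restrictScalars k
      refine FiniteDimensional.of_injective φ ?_
      rw [injective_iff_map_eq_zero]
      intro x hx
      obtain ⟨a, rfl⟩ := Submodule.Quotient.mk_surjective _ x
      rw [Submodule.Quotient.mk_eq_zero]
      exact ⟨(Submodule.Quotient.mk_eq_zero _).1 (congrArg Prod.fst hx),
        (Submodule.Quotient.mk_eq_zero _).1 (congrArg Prod.snd hx)⟩
    · change f a + g a = 0
      rw [hfI a ha.1, hgJ a ha.2, add_zero]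
  smul_mem' := by
    rintro c f ⟨I, hI, hIf, hfI⟩
    exact ⟨I, hI, hIf, fun a ha => by change c • f a = 0; rw [hfI a ha, smul_zero]⟩

/-- The finite dual `A°`: the space of the functionals on `A` that vanish on some two-sided ideal
of finite codimension. -/
def FiniteDual : Type (max u v) := ↥(finiteDualSubmodule k A)

instance : AddCommGroup (FiniteDual k A) :=
  inferInstanceAs (AddCommGroup ↥(finiteDualSubmodule k A))

instance : Module k (FiniteDual k A) :=
  inferInstanceAs (Module k ↥(finiteDualSubmodule k A))

/-- The inclusion of `A°` in the space of all functionals on `A`. -/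
def FiniteDual.incl : FiniteDual k A →ₗ[k] (A →ₗ[k] k) := (finiteDualSubmodule k A).subtype

/-- The pairing of `A° ⊗ A°` with `A ⊗ A`, `⟨f ⊗ g, a ⊗ b⟩ = f a * g b`. -/
def finiteDualPairing :
    FiniteDual k A ⊗[k] FiniteDual k A →ₗ[k] Module.Dual k (A ⊗[k] A) :=
  TensorProduct.dualDistrib k A A ∘ₗ
    TensorProduct.map (FiniteDual.incl k A) (FiniteDual.incl k A)

variable {k A}

/-- Evaluation at `a`, as a functional on `A°`. -/
def evalAt (a : A) : FiniteDual k A →ₗ[k] k := Module.Dual.eval k A a ∘ₗ (FiniteDual.incl k A)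

theorem evalAt_apply (a : A) (f : FiniteDual k A) : evalAt a f = FiniteDual.incl k A f a := rfl

theorem evalAt_separates (f : FiniteDual k A) (h : ∀ a : A, evalAt (k := k) a f = 0) : f = 0 :=
  Subtype.ext (LinearMap.ext h)

theorem finiteDualPairing_apply (t : FiniteDual k A ⊗[k] FiniteDual k A) (a b : A) :
    finiteDualPairing k A t (a ⊗ₜ b) =
      evalAt b (TensorProduct.lid k _ ((evalAt a).rTensor (FiniteDual k A) t)) := by
  induction t with
  | zero => simp
  | tmul f g => simp [finiteDualPairing, evalAt_apply]
  | add s t hs ht => simp only [map_add, LinearMap.add_apply, hs, ht]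

theorem finiteDualPairing_injective : Function.Injective (finiteDualPairing k A) := by
  rw [injective_iff_map_eq_zero]
  intro t ht
  refine eq_zero_of_rTensor (fun a : A => evalAt a) evalAt_separates t fun a => ?_
  apply (TensorProduct.lid k _).injective
  rw [map_zero]
  refine evalAt_separates _ fun b => ?_
  rw [← finiteDualPairing_apply, ht, LinearMap.zero_apply]

/-- The multiplication of `A` carries `A°` into `A° ⊗ A°`. -/
theorem dualMap_mul_mem (f : FiniteDual k A) :
    (LinearMap.mul' k A).dualMap (FiniteDual.incl k A f) ∈ LinearMap.range (finiteDualPairing k A) := by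
  obtain ⟨f, I, hI, hfin, hf⟩ := f
  let q : A →ₗ[k] A ⧸ I := (Ideal.Quotient.mkₐ k I).toLinearMap
  have hq : ∀ a ∈ I, q a = 0 := fun a ha => Ideal.Quotient.eq_zero_iff_mem.2 ha
  let qs : Module.Dual k (A ⧸ I) →ₗ[k] FiniteDual k A :=
    q.dualMap.codRestrict (finiteDualSubmodule k A) fun h => ⟨I, hI, hfin, fun a ha => by
      change h (q a) = 0
      rw [hq a ha, map_zero]⟩
  obtain ⟨F, hF⟩ : ∃ F : (A ⧸ I) →ₗ[k] k, ∀ a, F (q a) = f a :=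
    ⟨Submodule.liftQ (I.restrictScalars k) f (fun a ha => hf a ha), fun a => rfl⟩
  let s := (TensorProduct.dualDistribEquiv k (A ⧸ I) (A ⧸ I)).symm
    ((LinearMap.mul' k (A ⧸ I)).dualMap F)
  have hs : TensorProduct.dualDistrib k (A ⧸ I) (A ⧸ I) s = (LinearMap.mul' k (A ⧸ I)).dualMap F :=
    (TensorProduct.dualDistribEquiv k (A ⧸ I) (A ⧸ I)).apply_symm_apply _
  refine ⟨TensorProduct.map qs qs s, ?_⟩
  ext a b
  have key : ∀ t, finiteDualPairing k A (TensorProduct.map qs qs t) (a ⊗ₜ b) =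
      TensorProduct.dualDistrib k (A ⧸ I) (A ⧸ I) t (q a ⊗ₜ q b) := by
    intro t
    induction t with
    | zero => simp
    | tmul x y => rfl
    | add x y hx hy => simp only [map_add, LinearMap.add_apply, hx, hy]
  change finiteDualPairing k A (TensorProduct.map qs qs s) (a ⊗ₜ b) = f (a * b)
  rw [key, hs, ← hF]
  change F (q a * q b) = F (q (a * b))
  congr 1

/-- The comultiplication of `A°`: `Δ f` is the element of `A° ⊗ A°` with
`⟨Δ f, a ⊗ b⟩ = f (a * b)`. -/
def finiteDualComul : FiniteDual k A →ₗ[k] FiniteDual k A ⊗[k] FiniteDual k A :=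
  LinearMap.codRestrictOfInjective ((LinearMap.mul' k A).dualMap ∘ₗ (FiniteDual.incl k A))
    (finiteDualPairing k A) finiteDualPairing_injective dualMap_mul_mem

theorem finiteDualPairing_comul (f : FiniteDual k A) (a b : A) :
    finiteDualPairing k A (finiteDualComul f) (a ⊗ₜ b) = FiniteDual.incl k A f (a * b) := by
  have := LinearMap.codRestrictOfInjective_comp_apply
    ((LinearMap.mul' k A).dualMap ∘ₗ (FiniteDual.incl k A))
    (finiteDualPairing k A) finiteDualPairing_injective dualMap_mul_mem f
  exact LinearMap.congr_fun this (a ⊗ₜ b)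

/-- The coalgebra structure of `A°`, dual to the algebra structure of `A`; the counit is
evaluation at `1`. -/
instance : Coalgebra k (FiniteDual k A) where
  comul := finiteDualComul
  counit := evalAt 1
  coassoc := by
    ext f
    rw [← sub_eq_zero]
    refine eq_zero_of_rTensor (fun a : A => evalAt a) evalAt_separates _ fun a => ?_
    apply (TensorProduct.lid k _).injective
    rw [map_zero]
    apply finiteDualPairing_injective
    rw [map_zero]
    ext b c
    have h1 : ∀ t : FiniteDual k A ⊗[k] FiniteDual k A,
        finiteDualPairing k A (TensorProduct.lid k _ ((evalAt a).rTensor _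
          (TensorProduct.assoc k _ _ _ (finiteDualComul.rTensor (FiniteDual k A) t)))) (b ⊗ₜ c) =
        finiteDualPairing k A t ((a * b) ⊗ₜ c) := by
      intro t
      induction t with
      | zero => simp
      | add x y hx hy => simp only [map_add, LinearMap.add_apply, hx, hy]
      | tmul x y =>
        have e : finiteDualPairing k A (x ⊗ₜ y) ((a * b) ⊗ₜ c) =
          finiteDualPairing k A (finiteDualComul x) (a ⊗ₜ b) * FiniteDual.incl k A y c := by
            rw [finiteDualPairing_comul]; rfl
        rw [e, LinearMap.rTensor_tmul]
        generalize finiteDualComul x = s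
        induction s with
        | zero => simp
        | tmul x' y' => simp [finiteDualPairing, evalAt_apply, mul_assoc]
        | add x' y' hx hy =>
          simp only [map_add, LinearMap.add_apply, TensorProduct.add_tmul, hx, hy, add_mul]
    have h2 : ∀ t : FiniteDual k A ⊗[k] FiniteDual k A,
        finiteDualPairing k A (TensorProduct.lid k _ ((evalAt a).rTensor _
          (finiteDualComul.lTensor (FiniteDual k A) t))) (b ⊗ₜ c) =
        finiteDualPairing k A t (a ⊗ₜ (b * c)) := by
      intro t
      induction t with
      | zero => simp
      | add x y hx hy => simp only [map_add, LinearMap.add_apply, hx, hy]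
      | tmul x y =>
        simp only [LinearMap.lTensor_tmul, LinearMap.rTensor_tmul, TensorProduct.lid_tmul,
          map_smul, LinearMap.smul_apply, finiteDualPairing_comul]
        rfl
    change finiteDualPairing k A (TensorProduct.lid k _ ((evalAt a).rTensor _
      (TensorProduct.assoc k _ _ _ (finiteDualComul.rTensor _ (finiteDualComul f)) -
        finiteDualComul.lTensor _ (finiteDualComul f)))) (b ⊗ₜ c) = 0
    rw [map_sub, map_sub, map_sub, LinearMap.sub_apply, h1, h2, finiteDualPairing_comul,
      finiteDualPairing_comul, mul_assoc, sub_self]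
  rTensor_counit_comp_comul := by
    ext f
    apply (TensorProduct.lid k _).injective
    rw [← sub_eq_zero]
    refine evalAt_separates _ fun b => ?_
    rw [map_sub, LinearMap.comp_apply, ← finiteDualPairing_apply, finiteDualPairing_comul]
    simp [evalAt_apply]
  lTensor_counit_comp_comul := by
    ext f
    apply (TensorProduct.rid k _).injective
    rw [← sub_eq_zero]
    refine evalAt_separates _ fun a => ?_
    have h : ∀ t : FiniteDual k A ⊗[k] FiniteDual k A,
        evalAt a (TensorProduct.rid k _ ((evalAt 1).lTensor (FiniteDual k A) t)) =
        finiteDualPairing k A t (a ⊗ₜ 1) := by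
      intro t
      induction t with
      | zero => simp
      | tmul x y => simp [finiteDualPairing, evalAt_apply, mul_comm]
      | add x y hx hy => simp only [map_add, LinearMap.add_apply, hx, hy]
    rw [map_sub, LinearMap.comp_apply, h, finiteDualPairing_comul]
    simp [evalAt_apply]

end FiniteDual

end ChainCoalg

end

/-! The idea is to dualize. In the convolution algebra `C^*`, let `J` be the ideal of functionals
vanishing on the socle, so that `C^*/J` is `C₀^* ≃ D`. The algebra `C^*` is complete for the
filtration by annihilators of the Loewy series, a filtration that contains the powers of `J`. If
`C^*` contains a copy of `D` and an element `x ∈ J` commuting with it, completeness gives an algebra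
map `D[[X]] → C^*` sending `X` to `x`. Its transpose sends `C` into `D[[X]]°` as a coalgebra map,
and what remains is to make it injective.

Centrality is used through `D ⊗ Dᵐᵒᵖ ≃ End_k D`. This algebra contains a separability idempotent
`e`. Separability lifts `D` to `C^*` one Loewy layer at a time, as in Wedderburn–Malcev
(`exists_algHom_lift`). Applying `e` to a `D`-bimodule lands in the centralizer of `D`, and since
`e` generates the unit ideal, this projection can be arranged to keep a functional nonzero where
needed.

The chain condition enters in `exists_uniformizer`: `x` is chosen so that `c ↼ x = 0` forces `c`
into the socle. If `c ≠ 0`, the last nonzero `c ↼ x^i` then lies in the socle, where the functionals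
are exactly those coming from `D`; hence some `d X^i` does not vanish on `c`. -/

namespace ChainCoalg

open scoped TensorProduct

/-! ### Central division algebras and the separability idempotent -/

section CentralDivision

open MulOpposite

variable {k : Type*} [Field k] {D : Type*} [DivisionRing D] [Algebra k D]
  [FiniteDimensional k D] [Algebra.IsCentral k D]

/-- As a module over `D ⊗ Dᵐᵒᵖ`, `D` is simple, and its endomorphisms are multiplications by central
elements, that is, by scalars. Every `k`-linear map therefore commutes with them, and Jacobson
density realizes it on a finite basis. -/
theorem mulLeftRight_surjective : Function.Surjective (AlgHom.mulLeftRight k D) := by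
  classical
  let _ : Module (D ⊗[k] Dᵐᵒᵖ) D := TensorProduct.Algebra.module
  have smul_def : ∀ (r : D ⊗[k] Dᵐᵒᵖ) (d : D), r • d = AlgHom.mulLeftRight k D r d :=
    fun r d => rfl
  have hsimple : IsSimpleModule (D ⊗[k] Dᵐᵒᵖ) D := by
    rw [isSimpleModule_iff_toSpanSingleton_surjective]
    refine ⟨inferInstance, fun d hd a => ⟨(a * d⁻¹) ⊗ₜ 1, ?_⟩⟩
    rw [LinearMap.toSpanSingleton_apply, smul_def, AlgHom.mulLeftRight_apply]
    simp [hd]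
  intro f
  have hend : ∀ (φ : Module.End (D ⊗[k] Dᵐᵒᵖ) D), ∃ c : k, ∀ d, φ d = c • d := by
    intro φ
    have h1 : ∀ d, φ d = d * φ 1 := fun d => by
      have := φ.map_smul (d ⊗ₜ 1) 1
      simpa only [smul_def, AlgHom.mulLeftRight_apply, mul_one, unop_one] using this
    have h2 : ∀ d, φ d = φ 1 * d := fun d => by
      have := φ.map_smul (1 ⊗ₜ op d) 1
      simpa only [smul_def, AlgHom.mulLeftRight_apply, mul_one, one_mul, unop_op] using this
    have hc : φ 1 ∈ Subalgebra.center k D :=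
      Subalgebra.mem_center_iff.2 fun d => by rw [← h1, h2]
    obtain ⟨c, hc⟩ := Algebra.mem_bot.1 (Algebra.IsCentral.out hc)
    exact ⟨c, fun d => by rw [h2, ← hc, Algebra.smul_def]⟩
  let f' : Module.End (Module.End (D ⊗[k] Dᵐᵒᵖ) D) D :=
    { f with
      map_smul' := fun φ d => by
        obtain ⟨c, hc⟩ := hend φ
        change f (φ d) = φ (f d)
        rw [hc, hc, map_smul] }
  let b := Module.finBasis k D
  obtain ⟨r, hr⟩ := jacobson_density (R := D ⊗[k] Dᵐᵒᵖ) f' (Finset.univ.image b)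
  refine ⟨r, b.ext fun i => ?_⟩
  exact (hr (b i) (by simp)).symm

theorem mulLeftRight_bijective : Function.Bijective (AlgHom.mulLeftRight k D) := by
  have h : Module.finrank k (D ⊗[k] Dᵐᵒᵖ) = Module.finrank k (Module.End k D) := by
    rw [Module.finrank_tensorProduct, Module.finrank_linearMap,
      ← (opLinearEquiv k : D ≃ₗ[k] Dᵐᵒᵖ).finrank_eq]
  exact ⟨(LinearMap.injective_iff_surjective_of_finrank_eq_finrank h
    (f := (AlgHom.mulLeftRight k D).toLinearMap)).2 mulLeftRight_surjective,
    mulLeftRight_surjective⟩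

variable (k D) in
/-- A separability idempotent that generates `D ⊗ Dᵐᵒᵖ` as a two-sided ideal. -/
theorem exists_separability_idempotent : ∃ (lam : D →ₗ[k] k) (e : D ⊗[k] Dᵐᵒᵖ),
    lam 1 = 1 ∧ AlgHom.mulLeftRight k D e 1 = 1 ∧
    (∀ a : D, (a ⊗ₜ 1) * e = (1 ⊗ₜ op a) * e) ∧
    ∃ (n : ℕ) (u v : Fin n → D ⊗[k] Dᵐᵒᵖ), ∑ j, u j * e * v j = 1 := by
  obtain ⟨lam, hlam⟩ : ∃ lam : D →ₗ[k] k, lam 1 = 1 :=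
    Module.Projective.exists_dual_ne_zero k (one_ne_zero (α := D)) |>.elim fun f hf =>
      ⟨(f 1)⁻¹ • f, by simp [hf]⟩
  -- `e` is the element acting on `D` as `d ↦ lam d • 1`. Identities about `e` can then be checked
  -- on `D`: for instance `a ⊗ 1` and `1 ⊗ op a` agree after `e` because both send `1` to `a`.
  obtain ⟨e, he⟩ := mulLeftRight_surjective (lam.smulRight (1 : D))
  have he' : ∀ d, AlgHom.mulLeftRight k D e d = lam d • (1 : D) := fun d => by rw [he]; rfl
  refine ⟨lam, e, hlam, by rw [he', hlam, one_smul], fun a => ?_, ?_⟩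
  · apply mulLeftRight_bijective.1
    ext d
    simp [he']
  · let b := Module.finBasis k D
    -- With `v j` acting as the `j`-th coordinate times `1`, the product `(b j ⊗ 1) * e * v j` is
    -- the projection to the `j`-th basis line, and these projections sum to the identity.
    choose v hv using fun j => mulLeftRight_surjective ((b.coord j).smulRight (1 : D))
    refine ⟨_, fun j => b j ⊗ₜ 1, v, mulLeftRight_bijective.1 ?_⟩
    ext d
    have : ∀ j, AlgHom.mulLeftRight k D (v j) d = b.repr d j • (1 : D) := fun j => by rw [hv]; rfl
    simp only [map_sum, map_mul, map_one, LinearMap.sum_apply, Module.End.mul_apply, this, he',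
      map_smul, hlam, AlgHom.mulLeftRight_apply, mul_one, unop_one, Module.End.one_apply, one_smul,
      b.sum_repr]

end CentralDivision

/-! ### Lifting multiplicative maps along a separable algebra -/

section Lifting

open MulOpposite

variable {k : Type*} [Field k] {D : Type*} [Ring D] [Algebra k D]
  {A : Type*} [Ring A] [Algebra k A]

/-- A unital linear map that is multiplicative modulo `F` can be corrected by elements of `F` so as
to be multiplicative modulo `F'`, if `F * F ⊆ F'` and `D` is separable. -/
theorem exists_mul_lift (e : D ⊗[k] Dᵐᵒᵖ) (he1 : AlgHom.mulLeftRight k D e 1 = 1)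
    (he : ∀ a : D, (a ⊗ₜ 1) * e = (1 ⊗ₜ op a) * e) (F F' : Submodule k A)
    (hF : ∀ a, ∀ f ∈ F, a * f ∈ F) (hFF : ∀ f ∈ F, ∀ g ∈ F, f * g ∈ F')
    (s : D →ₗ[k] A) (hs1 : s 1 = 1) (hs : ∀ a b, s a * s b - s (a * b) ∈ F) :
    ∃ s' : D →ₗ[k] A, s' 1 = 1 ∧ (∀ a b, s' a * s' b - s' (a * b) ∈ F') ∧
      ∀ a, s' a - s a ∈ F := by
  obtain ⟨n, x, y, rfl⟩ : ∃ (n : ℕ) (x y : Fin n → D), e = ∑ i, x i ⊗ₜ[k] op (y i) := by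
    obtain ⟨S, hS⟩ := TensorProduct.exists_finset e
    refine ⟨S.card, fun i => (S.equivFin.symm i).1.1, fun i => unop (S.equivFin.symm i).1.2, ?_⟩
    rw [hS, ← Finset.sum_coe_sort]
    exact (Equiv.sum_comp S.equivFin.symm (fun p : S => p.1.1 ⊗ₜ[k] p.1.2)).symm
  let B : D →ₗ[k] D →ₗ[k] A :=
    (LinearMap.mul k A).compl₁₂ s s - (LinearMap.mul k D).compr₂ s
  have hB : ∀ a b, B a b = s a * s b - s (a * b) := fun a b => rfl
  simp only [← hB] at hs
  have hxy : ∑ i, s (x i * y i) = 1 := by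
    rw [← map_sum, ← hs1, ← he1]
    simp [AlgHom.mulLeftRight_apply]
  have hcomm : ∀ a b, ∑ i, s (a * x i) * B (y i) b = ∑ i, s (x i) * B (y i * a) b := by
    intro a b
    have := congrArg (TensorProduct.lift ((LinearMap.mul k A).compl₁₂ s
      (B.flip b ∘ₗ (opLinearEquiv k).symm.toLinearMap))) (he a)
    simpa [Finset.mul_sum] using this
  -- The defect `B` is a Hochschild 2-cocycle up to terms in `F * F`. The separability idempotent
  -- provides a contracting homotopy, and `h` is the resulting cochain that cobounds `B`.
  let h : D →ₗ[k] A := ∑ i, LinearMap.mulLeft k (s (x i)) ∘ₗ B (y i)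
  have hh : ∀ a, h a = ∑ i, s (x i) * B (y i) a := fun a => by simp [h]
  have hhF : ∀ a, h a ∈ F := fun a => by
    rw [hh]; exact Submodule.sum_mem _ fun i _ => hF _ _ (hs _ _)
  refine ⟨s - h, ?_, fun a b => ?_, fun a => ?_⟩
  · simp [hh, hB, hs1]
  · have key : (s - h) a * (s - h) b - (s - h) (a * b) =
        h a * h b - ∑ i, B a (x i) * B (y i) b - ∑ i, B (x i) (y i) * B a b := by
      have e1 : s a * h b = ∑ i, B a (x i) * B (y i) b + ∑ i, s (x i) * B (y i * a) b := by
        rw [← hcomm, hh, Finset.mul_sum, ← Finset.sum_add_distrib]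
        refine Finset.sum_congr rfl fun i _ => ?_
        rw [hB a]; noncomm_ring
      -- This is the exact identity `s y * B a b = B (y * a) b - B y (a * b) + B y a * s b`,
      -- multiplied by `s (x i)` at `y = y i` and summed, with `∑ s (x i * y i) = 1`.
      have e2 : ∑ i, s (x i) * B (y i * a) b - h (a * b) + h a * s b =
          ∑ i, B (x i) (y i) * B a b + B a b := by
        have : B a b = ∑ i, s (x i * y i) * B a b := by rw [← Finset.sum_mul, hxy, one_mul]
        conv_rhs => rw [this]
        rw [hh, hh, Finset.sum_mul, ← Finset.sum_sub_distrib, ← Finset.sum_add_distrib,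
          ← Finset.sum_add_distrib]
        refine Finset.sum_congr rfl fun i _ => ?_
        rw [← this]
        simp only [hB, mul_assoc]
        noncomm_ring
      have e3 : (s - h) a * (s - h) b - (s - h) (a * b) =
          B a b - s a * h b - (h a * s b - h (a * b)) + h a * h b := by
        simp only [LinearMap.sub_apply, hB]; noncomm_ring
      rw [e3, e1]
      rw [← sub_eq_zero] at e2 ⊢
      rw [← neg_eq_zero, ← e2]
      abel
    rw [key]
    exact sub_mem (sub_mem (hFF _ (hhF _) _ (hhF _))
      (Submodule.sum_mem _ fun i _ => hFF _ (hs _ _) _ (hs _ _)))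
      (Submodule.sum_mem _ fun i _ => hFF _ (hs _ _) _ (hs _ _))
  · simpa using neg_mem (hhF a)

end Lifting

open WithConv

theorem eq_of_forall_conv {k : Type*} [Field k] {C : Type*} [AddCommGroup C] [Module k C] {x y : C}
    (h : ∀ f : WithConv (C →ₗ[k] k), f x = f y) : x = y := by
  rw [← sub_eq_zero]
  refine eq_of_all_dual (k := k) _ fun f => ?_
  rw [map_sub, sub_eq_zero]
  exact h (toConv f)

/-! ### The dual algebra and the Loewy filtration -/

section Loewy

variable {k : Type*} [Field k] {C : Type*} [AddCommGroup C] [Module k C] [Coalgebra k C]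

theorem conv_mul_apply_leftHit (f g : WithConv (C →ₗ[k] k)) (c : C) :
    (f * g) c = f (leftHit g.ofConv c) := by
  rw [LinearMap.convMul_apply, leftHit]
  simp only [LinearMap.comp_apply, LinearEquiv.coe_coe]
  generalize Coalgebra.comul (R := k) c = t
  induction t with
  | zero => simp
  | tmul a b => simp [mul_comm]
  | add a b ha hb => simp only [map_add, ha, hb]

theorem conv_mul_apply_rightHit (f g : WithConv (C →ₗ[k] k)) (c : C) :
    (f * g) c = g (rightHit f.ofConv c) := by
  rw [LinearMap.convMul_apply, rightHit]
  simp only [LinearMap.comp_apply, LinearEquiv.coe_coe]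
  generalize Coalgebra.comul (R := k) c = t
  induction t with
  | zero => simp
  | tmul a b => simp
  | add a b ha hb => simp only [map_add, ha, hb]

theorem leftHit_mul (f g : WithConv (C →ₗ[k] k)) (c : C) :
    leftHit (f * g).ofConv c = leftHit f.ofConv (leftHit g.ofConv c) :=
  eq_of_forall_conv (k := k) fun h => by
    simp only [← conv_mul_apply_leftHit, mul_assoc]

theorem rightHit_mul (f g : WithConv (C →ₗ[k] k)) (c : C) :
    rightHit (f * g).ofConv c = rightHit g.ofConv (rightHit f.ofConv c) :=
  eq_of_forall_conv (k := k) fun h => by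
    simp only [← conv_mul_apply_rightHit, mul_assoc]

theorem leftHit_one (c : C) : leftHit (1 : WithConv (C →ₗ[k] k)).ofConv c = c :=
  eq_of_forall_conv (k := k) fun h => by rw [← conv_mul_apply_leftHit, mul_one]

theorem rightHit_one (c : C) : rightHit (1 : WithConv (C →ₗ[k] k)).ofConv c = c :=
  eq_of_forall_conv (k := k) fun h => by rw [← conv_mul_apply_rightHit, one_mul]

/-- Every element lies in a finite-dimensional right coideal. -/
theorem exists_finiteDimensional_coideal (c : C) :
    ∃ N : Submodule k C, IsRightCoideal N ∧ FiniteDimensional k N ∧ c ∈ N := by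
  let hit : WithConv (C →ₗ[k] k) →ₗ[k] C :=
    { toFun := fun f => leftHit f.ofConv c
      map_add' := fun f g => by simp [leftHit, LinearMap.lTensor_add]
      map_smul' := fun r f => by simp [leftHit, LinearMap.lTensor_smul] }
  refine ⟨LinearMap.range hit, (isRightCoideal_iff _).2 ?_, ?_, 1, leftHit_one c⟩
  · rintro f _ ⟨g, rfl⟩
    exact ⟨toConv f * g, leftHit_mul _ _ _⟩
  · obtain ⟨S, hS⟩ := TensorProduct.exists_finset (Coalgebra.comul (R := k) c)
    have hle : LinearMap.range hit ≤ Submodule.span k ((fun p : C × C => p.1) '' (S : Set (C × C))) := by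
      rintro _ ⟨f, rfl⟩
      change leftHit f.ofConv c ∈ _
      simp only [leftHit, LinearMap.comp_apply, hS, map_sum]
      refine Submodule.sum_mem _ fun p hp => ?_
      simpa using Submodule.smul_mem _ (f.ofConv p.2) (Submodule.subset_span (Set.mem_image_of_mem (fun p : C × C => p.1) hp))
    have : FiniteDimensional k (Submodule.span k ((fun p : C × C => p.1) '' (S : Set (C × C)))) :=
      FiniteDimensional.span_of_finite k (S.finite_toSet.image _)
    exact Submodule.finiteDimensional_of_le hle

theorem isRightCoideal_ker_rightHit (g : C →ₗ[k] k) :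
    IsRightCoideal (LinearMap.ker (rightHit g)) := by
  rw [isRightCoideal_iff]
  intro f x hx
  rw [LinearMap.mem_ker] at hx ⊢
  rw [← leftHit_rightHit, hx, map_zero]

/-- A finite-dimensional nonzero right coideal contains a simple one, by descent on the dimension.
-/
theorem inf_socle_ne_bot (N : Submodule k C) (hN : IsRightCoideal N) [FiniteDimensional k N]
    (h0 : N ≠ ⊥) : N ⊓ socle k C ≠ ⊥ := by
  induction hn : Module.finrank k N using Nat.strong_induction_on generalizing N with
  | _ n ih =>
    subst hn
    by_cases hs : IsSimpleRightCoideal N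
    · have hle : N ≤ socle k C := le_sSup hs
      rwa [inf_eq_left.2 hle]
    · obtain ⟨M, hM, hMN, hM0, hne⟩ : ∃ M : Submodule k C, IsRightCoideal M ∧ M ≤ N ∧ M ≠ ⊥ ∧
          M ≠ N := by
        by_contra! h
        exact hs ⟨hN, h0, fun M hM hMN => or_iff_not_imp_left.2 (h M hM hMN)⟩
      have := Submodule.finiteDimensional_of_le hMN
      intro h
      refine ih _ (Submodule.finrank_lt_finrank_of_lt (lt_of_le_of_ne hMN hne)) M hM hM0 rfl ?_
      exact eq_bot_iff.2 ((inf_le_inf_right _ hMN).trans h.le)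

variable (k C) in
/-- The Loewy series of `C`, starting with the socle. -/
def loewy : ℕ → Submodule k C
  | 0 => socle k C
  | n + 1 => ⨅ g : {g : C →ₗ[k] k // ∀ c ∈ socle k C, g c = 0}, (loewy n).comap (rightHit g.1)

theorem mem_loewy_succ {n : ℕ} {c : C} : c ∈ loewy k C (n + 1) ↔
    ∀ g : C →ₗ[k] k, (∀ c ∈ socle k C, g c = 0) → rightHit g c ∈ loewy k C n := by
  simp [loewy]

theorem leftHit_mem_loewy (n : ℕ) (f : C →ₗ[k] k) {c : C} (hc : c ∈ loewy k C n) :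
    leftHit f c ∈ loewy k C n := by
  induction n generalizing c with
  | zero => exact (isRightCoideal_iff _).1 (isRightCoideal_socle k C) f c hc
  | succ n ih =>
    rw [mem_loewy_succ] at hc ⊢
    intro g hg
    rw [← leftHit_rightHit]
    exact ih (hc g hg)

/-- Functionals vanishing on the socle form a left ideal of `C^*`: if `g` is one, so is `f * g`, and
`(c ↼ f) ↼ g = c ↼ (f * g)`. -/
theorem rightHit_mem_loewy (n : ℕ) (f : C →ₗ[k] k) {c : C} (hc : c ∈ loewy k C n) :
    rightHit f c ∈ loewy k C n := by
  cases n with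
  | zero => exact rightHit_socle k C f c hc
  | succ n =>
    rw [mem_loewy_succ] at hc ⊢
    intro g hg
    have := hc (toConv f * toConv g).ofConv fun c hc => by
      change (toConv f * toConv g) c = 0
      rw [conv_mul_apply_rightHit]
      exact hg _ (rightHit_socle k C f c hc)
    rwa [rightHit_mul] at this

theorem rightHit_eq_zero_of_socle (g : C →ₗ[k] k) (hg : ∀ c ∈ socle k C, g c = 0) {c : C}
    (hc : c ∈ socle k C) : rightHit g c = 0 :=
  eq_of_forall_conv (k := k) fun h => by
    have := conv_mul_apply_rightHit (toConv g) h c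
    rw [← this, map_zero, conv_mul_apply_leftHit]
    exact hg _ ((isRightCoideal_iff _).1 (isRightCoideal_socle k C) _ c hc)

theorem loewy_mono : Monotone (loewy k C) := by
  refine monotone_nat_of_le_succ fun n => ?_
  induction n with
  | zero =>
    intro c hc
    rw [mem_loewy_succ]
    intro g hg
    rw [rightHit_eq_zero_of_socle g hg hc]
    exact zero_mem _
  | succ n ih =>
    intro c hc
    rw [mem_loewy_succ] at hc ⊢
    exact fun g hg => ih (hc g hg)

/-- If `g` vanishes on the socle, then `· ↼ g` kills the nonzero space `N ⊓ socle`, so `N ↼ g` is a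
right coideal of smaller dimension. The index is one more than needed for nonzero `N`, since the
series starts at the socle; this is harmless. -/
theorem le_loewy_finrank (N : Submodule k C) (hN : IsRightCoideal N) [FiniteDimensional k N] :
    N ≤ loewy k C (Module.finrank k N) := by
  induction hn : Module.finrank k N using Nat.strong_induction_on generalizing N with
  | _ n ih =>
    subst hn
    by_cases h0 : N = ⊥
    · subst h0; exact bot_le
    · have hpos : 0 < Module.finrank k N := by
        have := Submodule.one_le_finrank_iff.2 h0
        omega
      obtain ⟨m, hm⟩ := Nat.exists_eq_succ_of_ne_zero hpos.ne'
      intro c hc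
      rw [hm, mem_loewy_succ]
      intro g hg
      have hlt : Module.finrank k (N.map (rightHit g)) < Module.finrank k N := by
        obtain ⟨z, hz, hz0⟩ := Submodule.exists_mem_ne_zero_of_ne_bot (inf_socle_ne_bot N hN h0)
        have hrn := ((rightHit g).domRestrict N).finrank_range_add_finrank_ker
        rw [LinearMap.range_domRestrict] at hrn
        have : 0 < Module.finrank k (LinearMap.ker ((rightHit g).domRestrict N)) := by
          refine Submodule.one_le_finrank_iff.2 fun hker => hz0 ?_
          have : (⟨z, hz.1⟩ : N) ∈ LinearMap.ker ((rightHit g).domRestrict N) :=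
            rightHit_eq_zero_of_socle g hg hz.2
          rw [hker, Submodule.mem_bot] at this
          exact congrArg Subtype.val this
        omega
      have := ih _ hlt (N.map (rightHit g)) (isRightCoideal_map_rightHit g N hN) rfl
      exact loewy_mono (by omega) (this ⟨c, hc, rfl⟩)

theorem exists_mem_loewy (c : C) : ∃ n, c ∈ loewy k C n := by
  obtain ⟨N, hN, hfin, hc⟩ := exists_finiteDimensional_coideal (k := k) c
  exact ⟨_, le_loewy_finrank N hN hc⟩

variable (k C) in
/-- The functionals that vanish on a term of the Loewy series. -/
def loewyAnnihilator (n : ℕ) : Submodule k (WithConv (C →ₗ[k] k)) where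
  carrier := {f | ∀ c ∈ loewy k C n, f c = 0}
  zero_mem' := fun _ _ => rfl
  add_mem' := fun {f g} hf hg c hc => by
    change f c + g c = 0
    rw [hf c hc, hg c hc, add_zero]
  smul_mem' := fun r f hf c hc => by
    change r • f c = 0
    rw [hf c hc, smul_zero]

theorem loewyAnnihilator_anti : Antitone (loewyAnnihilator k C) :=
  fun _ _ h _ hf c hc => hf c (loewy_mono h hc)

theorem mul_mem_loewyAnnihilator_left (n : ℕ) (f : WithConv (C →ₗ[k] k))
    {g : WithConv (C →ₗ[k] k)} (hg : g ∈ loewyAnnihilator k C n) :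
    f * g ∈ loewyAnnihilator k C n := fun c hc => by
  rw [conv_mul_apply_rightHit]
  exact hg _ (rightHit_mem_loewy n _ hc)

theorem mul_mem_loewyAnnihilator_right (n : ℕ) (f : WithConv (C →ₗ[k] k))
    {g : WithConv (C →ₗ[k] k)} (hg : g ∈ loewyAnnihilator k C n) :
    g * f ∈ loewyAnnihilator k C n := fun c hc => by
  rw [conv_mul_apply_leftHit]
  exact hg _ (leftHit_mem_loewy n _ hc)

theorem mul_mem_loewyAnnihilator_succ {n : ℕ} {f g : WithConv (C →ₗ[k] k)}
    (hf : f ∈ loewyAnnihilator k C 0) (hg : g ∈ loewyAnnihilator k C n) :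
    f * g ∈ loewyAnnihilator k C (n + 1) := fun c hc => by
  rw [conv_mul_apply_rightHit]
  exact hg _ (mem_loewy_succ.1 hc _ hf)

theorem pow_mem_loewyAnnihilator {f : WithConv (C →ₗ[k] k)}
    (hf : f ∈ loewyAnnihilator k C 0) (n : ℕ) : f ^ (n + 1) ∈ loewyAnnihilator k C n := by
  induction n with
  | zero => simpa using hf
  | succ n ih => rw [pow_succ']; exact mul_mem_loewyAnnihilator_succ hf ih

/-- The filtration is separated because the Loewy series exhausts `C`. -/
theorem eq_of_sub_mem_loewyAnnihilator {f g : WithConv (C →ₗ[k] k)}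
    (h : ∀ n, f - g ∈ loewyAnnihilator k C n) : f = g := by
  ext c
  obtain ⟨n, hn⟩ := exists_mem_loewy (k := k) c
  exact sub_eq_zero.1 (h n c hn)

/-- The dual algebra is complete for the filtration by the annihilators of the Loewy series. -/
theorem exists_limit {V : Type*} [AddCommGroup V] [Module k V]
    (s : ℕ → V →ₗ[k] WithConv (C →ₗ[k] k))
    (hs : ∀ n v, s (n + 1) v - s n v ∈ loewyAnnihilator k C n) :
    ∃ t : V →ₗ[k] WithConv (C →ₗ[k] k), ∀ n v, t v - s n v ∈ loewyAnnihilator k C n := by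
  have hle : ∀ n m, n ≤ m → ∀ v, ∀ c ∈ loewy k C n, s m v c = s n v c := by
    intro n m hnm
    induction m, hnm using Nat.le_induction with
    | base => exact fun _ _ _ => rfl
    | succ m hm ih =>
      intro v c hc
      rw [← ih v c hc]
      exact sub_eq_zero.1 (hs m v c (loewy_mono hm hc))
  -- The limit is evaluated at `c` with the approximation of index `N c`, a Loewy level containing
  -- `c`; from there on the values at `c` are constant.
  choose N hN using exists_mem_loewy (k := k) (C := C)
  have hstab : ∀ n v, ∀ c ∈ loewy k C n, s (N c) v c = s n v c := fun n v c hc => by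
    rcases le_total n (N c) with h | h
    · exact hle _ _ h v c hc
    · exact (hle _ _ h v c (hN c)).symm
  refine ⟨{ toFun := fun v => toConv
              { toFun := fun c => s (N c) v c
                map_add' := fun c d => ?_
                map_smul' := fun r c => ?_ }
            map_add' := fun v w => ?_
            map_smul' := fun r v => ?_ }, fun n v c hc => ?_⟩
  · have hc := loewy_mono (le_max_left (N c) (N d)) (hN c)
    have hd := loewy_mono (le_max_right (N c) (N d)) (hN d)
    rw [hstab _ v _ hc, hstab _ v _ hd, hstab _ v _ (add_mem hc hd), map_add]
  · rw [hstab _ v _ (Submodule.smul_mem _ r (hN c)), map_smul, RingHom.id_apply]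
  · ext c
    change s (N c) (v + w) c = s (N c) v c + s (N c) w c
    rw [map_add]; rfl
  · ext c
    change s (N c) (r • v) c = r • s (N c) v c
    rw [map_smul]; rfl
  · exact sub_eq_zero.2 (hstab n v c hc)

theorem mul_sub_mul_mem_loewyAnnihilator {n : ℕ} {a a' b b' : WithConv (C →ₗ[k] k)}
    (ha : a - a' ∈ loewyAnnihilator k C n) (hb : b - b' ∈ loewyAnnihilator k C n) :
    a * b - a' * b' ∈ loewyAnnihilator k C n := by
  have : a * b - a' * b' = (a - a') * b + a' * (b - b') := by rw [sub_mul, mul_sub]; abel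
  rw [this]
  exact add_mem (mul_mem_loewyAnnihilator_right n _ ha) (mul_mem_loewyAnnihilator_left n _ hb)

end Loewy

/-! ### Lifting `D` to the dual algebra, and the uniformizer -/

section Chain

variable {k : Type*} [Field k] {D : Type*} [DivisionRing D] [Algebra k D]
  [FiniteDimensional k D] [Algebra.IsCentral k D]
  {C : Type*} [AddCommGroup C] [Module k C] [Coalgebra k C]

theorem coradical_conv_mul_apply (f g : WithConv (C →ₗ[k] k)) (c : coradical k C) :
    (f * g) (c : C) = (toConv (f.ofConv ∘ₗ (coradical k C).carrier.subtype) *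
      toConv (g.ofConv ∘ₗ (coradical k C).carrier.subtype)) c := by
  rw [LinearMap.convMul_apply, LinearMap.convMul_apply, ← (coradical k C).map_comul,
    ofConv_toConv, ofConv_toConv, TensorProduct.map_comp]
  rfl

/-- An algebra homomorphism from a central division algebra to the dual of the coradical lifts to
the dual of the whole coalgebra. -/
theorem exists_algHom_lift (φ : D →ₐ[k] WithConv (coradical k C →ₗ[k] k)) :
    ∃ ψ : D →ₐ[k] WithConv (C →ₗ[k] k), ∀ d, ∀ c : coradical k C, ψ d (c : C) = φ d c := by
  obtain ⟨lam, e, hlam, he1, he, -⟩ := exists_separability_idempotent k D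
  obtain ⟨p, hp⟩ := exists_projection (socle k C)
  have hp' : ∀ c : socle k C, p c = c := fun c => LinearMap.congr_fun hp c
  let r : D →ₗ[k] WithConv (C →ₗ[k] k) :=
    { toFun := fun d => toConv ((φ d).ofConv ∘ₗ p)
      map_add' := fun a b => by rw [map_add]; rfl
      map_smul' := fun a b => by rw [map_smul]; rfl }
  have hr : ∀ d, ∀ c : socle k C, r d (c : C) = φ d c := fun d c => by
    change φ d (p c) = φ d c
    rw [hp']
  have hr1 : ∀ c : socle k C, r 1 (c : C) = (1 : WithConv (C →ₗ[k] k)) (c : C) := fun c => by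
    rw [hr, map_one]; rfl
  -- The extra term makes the map unital, because `lam 1 = 1`. It does not alter values on the
  -- socle, where `r 1` is already the counit.
  let s₀ : D →ₗ[k] WithConv (C →ₗ[k] k) := r + lam.smulRight (1 - r 1)
  have hs₀ : ∀ d, ∀ c : socle k C, s₀ d (c : C) = φ d c := fun d c => by
    change r d (c : C) + lam d • ((1 : WithConv (C →ₗ[k] k)) (c : C) - r 1 (c : C)) = _
    rw [← hr1, sub_self, smul_zero, add_zero, hr]
  have h0 : s₀ 1 = 1 ∧ ∀ a b, s₀ a * s₀ b - s₀ (a * b) ∈ loewyAnnihilator k C 0 := by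
    refine ⟨by simp [s₀, hlam], fun a b c hc => ?_⟩
    refine sub_eq_zero.2 ?_
    have h1 : ∀ d, toConv ((s₀ d).ofConv ∘ₗ (coradical k C).carrier.subtype) = φ d := fun d => by
      ext c; exact hs₀ d c
    have := coradical_conv_mul_apply (s₀ a) (s₀ b) ⟨c, hc⟩
    rw [h1, h1, ← map_mul φ] at this
    exact this.trans (hs₀ _ ⟨c, hc⟩).symm
  let P : ℕ → (D →ₗ[k] WithConv (C →ₗ[k] k)) → Prop := fun n s =>
    s 1 = 1 ∧ ∀ a b, s a * s b - s (a * b) ∈ loewyAnnihilator k C n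
  -- Each correction gains one Loewy layer: the product of two elements of the `n`-th annihilator
  -- lies in the next one, since the first factor also vanishes on the socle.
  have step : ∀ n, ∀ s : {s // P n s}, ∃ s' : {s // P (n + 1) s}, ∀ a,
      s'.1 a - s.1 a ∈ loewyAnnihilator k C n := by
    rintro n ⟨s, hs1, hs⟩
    obtain ⟨s', h1, h2, h3⟩ := exists_mul_lift e he1 he (loewyAnnihilator k C n)
      (loewyAnnihilator k C (n + 1)) (fun a f hf => mul_mem_loewyAnnihilator_left n a hf)
      (fun f hf g hg => mul_mem_loewyAnnihilator_succ
        (loewyAnnihilator_anti (Nat.zero_le n) hf) hg) s hs1 hs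
    exact ⟨⟨s', h1, h2⟩, h3⟩
  choose next hnext using step
  let S : ∀ n, {s // P n s} := fun n => Nat.rec ⟨s₀, h0⟩ (fun n s => next n s) n
  obtain ⟨t, ht⟩ := exists_limit (fun n => (S n).1) fun n v => hnext n (S n) v
  refine ⟨AlgHom.ofLinearMap t ?_ fun a b => ?_, fun d c => ?_⟩
  · refine eq_of_sub_mem_loewyAnnihilator fun n => ?_
    have := ht n 1
    rwa [(S n).2.1] at this
  · refine eq_of_sub_mem_loewyAnnihilator fun n => ?_
    have h1 := mul_sub_mul_mem_loewyAnnihilator (ht n a) (ht n b)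
    have h2 := sub_mem (sub_mem (ht n (a * b)) ((S n).2.2 a b)) h1
    convert h2 using 1
    abel
  · exact (sub_eq_zero.1 (ht 0 d c c.2)).trans (hs₀ d c)

/-- `N ↼ g` is a right coideal of dimension at most that of `N`. Being comparable with `N`, it lies
inside `N`. -/
theorem rightHit_mem_of_finiteDimensional (hC : IsChainCoalgebra k C) (N : Submodule k C)
    (hN : IsRightCoideal N) [FiniteDimensional k N] (g : C →ₗ[k] k) :
    ∀ x ∈ N, rightHit g x ∈ N := by
  have hle : N.map (rightHit g) ≤ N := by
    rcases hC _ N (isRightCoideal_map_rightHit g N hN) hN with h | h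
    · exact h
    · exact (Submodule.eq_of_le_of_finrank_le h (Submodule.finrank_map_le _ _)).ge
  exact fun x hx => hle ⟨x, hx, rfl⟩

/-- A functional commuting with `D` whose right action on `C` has the socle as its kernel. -/
theorem exists_uniformizer (hC : IsChainCoalgebra k C) (ψ : D →ₐ[k] WithConv (C →ₗ[k] k)) :
    ∃ x : WithConv (C →ₗ[k] k), x ∈ loewyAnnihilator k C 0 ∧ (∀ d, Commute (ψ d) x) ∧
      ∀ c, rightHit x.ofConv c = 0 → c ∈ socle k C := by
  -- If `C` is its own socle, `x = 0` works.
  by_cases htop : ∀ c, c ∈ socle k C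
  · exact ⟨0, zero_mem _, fun d => Commute.zero_right _, fun c _ => htop c⟩
  push Not at htop
  obtain ⟨c₀, hc₀⟩ := htop
  let Q : ℕ → Prop := fun n => ∃ N : Submodule k C, IsRightCoideal N ∧ FiniteDimensional k N ∧
    ¬ N ≤ socle k C ∧ Module.finrank k N = n
  have hQ : ∃ n, Q n := by
    obtain ⟨N, h1, h2, h3⟩ := exists_finiteDimensional_coideal (k := k) c₀
    exact ⟨_, N, h1, h2, fun h => hc₀ (h h3), rfl⟩
  classical
  -- `N` has least dimension among the finite-dimensional right coideals outside the socle; `g`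
  -- below vanishes on the socle but not on `N`.
  obtain ⟨N, hN, hfin, hNs, hrank⟩ := Nat.find_spec hQ
  obtain ⟨c₁, hc₁, hc₁s⟩ := Set.not_subset.1 hNs
  obtain ⟨g, hg1, hg⟩ := Submodule.exists_dual_map_eq_bot_of_notMem hc₁s inferInstance
  have hg0 : toConv g ∈ loewyAnnihilator k C 0 := fun c hc => by
    have : g c ∈ (socle k C).map g := ⟨c, hc, rfl⟩
    rwa [hg, Submodule.mem_bot] at this
  obtain ⟨-, e, -, -, he, n, u, v, huv⟩ := exists_separability_idempotent k D
  let ρ : D ⊗[k] Dᵐᵒᵖ →ₐ[k] Module.End k (WithConv (C →ₗ[k] k)) :=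
    (AlgHom.mulLeftRight k (WithConv (C →ₗ[k] k))).comp (Algebra.TensorProduct.map ψ ψ.op)
  have hρ : ∀ a b f, ρ (a ⊗ₜ MulOpposite.op b) f = ψ a * f * ψ b := fun a b f => by
    simp [ρ]
  have hstable : ∀ (I : Submodule k (WithConv (C →ₗ[k] k))), (∀ f, ∀ g ∈ I, f * g ∈ I) →
      (∀ f, ∀ g ∈ I, g * f ∈ I) → ∀ t, ∀ f ∈ I, ρ t f ∈ I := by
    intro I hl hr t f hf
    induction t with
    | zero => simp
    | tmul a b => rw [← MulOpposite.op_unop b, hρ]; exact hr _ _ (hl _ _ hf)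
    | add s t hs ht => rw [map_add]; exact add_mem hs ht
  let W : Submodule k (WithConv (C →ₗ[k] k)) :=
    { carrier := {f | ∀ c ∈ N, f c = 0}
      zero_mem' := fun _ _ => rfl
      add_mem' := fun {f g} hf hg c hc => by
        change f c + g c = 0
        rw [hf c hc, hg c hc, add_zero]
      smul_mem' := fun r f hf c hc => by
        change r • f c = 0
        rw [hf c hc, smul_zero] }
  -- `W` is a two-sided ideal, hence stable under `D ⊗ Dᵐᵒᵖ`. If every `e * v j` sent `g` into `W`,
  -- then so would `∑ u j * e * v j = 1`, contradicting the choice of `g`.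
  obtain ⟨j, hj⟩ : ∃ j, ρ e (ρ (v j) (toConv g)) ∉ W := by
    by_contra! h
    refine hg1 ?_
    have : toConv g ∈ W := by
      have h1 : ρ (∑ j, u j * e * v j) (toConv g) = toConv g := by rw [huv, map_one]; rfl
      rw [← h1, map_sum, LinearMap.sum_apply]
      refine Submodule.sum_mem _ fun j _ => ?_
      rw [mul_assoc, map_mul, map_mul]
      refine hstable W (fun f g hg c hc => ?_) (fun f g hg c hc => ?_) _ _ (h j)
      · rw [conv_mul_apply_rightHit]
        exact hg _ (rightHit_mem_of_finiteDimensional hC N hN _ c hc)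
      · rw [conv_mul_apply_leftHit]
        exact hg _ ((isRightCoideal_iff N).1 hN _ c hc)
    exact this c₁ hc₁
  have hJ : ∀ t, ∀ f ∈ loewyAnnihilator k C 0, ρ t f ∈ loewyAnnihilator k C 0 :=
    hstable _ (fun f g hg => mul_mem_loewyAnnihilator_left 0 f hg)
      (fun f g hg => mul_mem_loewyAnnihilator_right 0 f hg)
  set x := ρ e (ρ (v j) (toConv g)) with hx
  have hx0 : x ∈ loewyAnnihilator k C 0 := hJ _ _ (hJ _ _ hg0)
  refine ⟨x, hx0, fun d => ?_, ?_⟩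
  -- Since `(d ⊗ 1) * e = (1 ⊗ op d) * e`, left and right multiplication by `ψ d` agree on the image
  -- of `e`.
  · have := congrArg (fun t => ρ t (ρ (v j) (toConv g))) (he d)
    simp only [map_mul, Module.End.mul_apply, ← hx] at this
    rw [← MulOpposite.op_one, hρ, hρ] at this
    exact (by simpa using this : ψ d * x = x * ψ d)
  · obtain ⟨c, hc, hxc⟩ : ∃ c ∈ N, x c ≠ 0 := by
      by_contra! h
      exact hj h
    have hker := isRightCoideal_ker_rightHit (C := C) x.ofConv
    have hcker : c ∉ LinearMap.ker (rightHit x.ofConv) := fun h => hxc <| by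
      rw [← mul_one x, conv_mul_apply_rightHit, LinearMap.mem_ker.1 h, map_zero]
    -- The kernel does not contain `N`, so the chain condition puts it strictly inside `N`;
    -- minimality of `N` then forces it into the socle.
    have hle : LinearMap.ker (rightHit x.ofConv) ≤ N :=
      (hC _ _ hker hN).resolve_right fun h => hcker (h hc)
    have hfin' := Submodule.finiteDimensional_of_le hle
    by_contra hns
    refine Nat.find_min hQ ?_ ⟨_, hker, hfin', fun h => hns fun c hc => h hc, rfl⟩
    rw [← hrank]
    exact Submodule.finrank_lt_finrank_of_lt (lt_of_le_of_ne hle fun h => hcker (h ▸ hc))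

end Chain

/-! ### Evaluating power series in the dual algebra -/

section PowerSeriesAction

variable {k : Type*} [Field k] {D : Type*} [Ring D] [Algebra k D]
  {C : Type*} [AddCommGroup C] [Module k C] [Coalgebra k C]

/-- The image of the `n`-th truncation of a power series. -/
noncomputable def truncEval (ψ : D →ₐ[k] WithConv (C →ₗ[k] k)) (x : WithConv (C →ₗ[k] k)) (n : ℕ) :
    PowerSeries D →ₗ[k] WithConv (C →ₗ[k] k) :=
  ∑ i ∈ Finset.range (n + 1), LinearMap.mulRight k (x ^ i) ∘ₗ ψ.toLinearMap ∘ₗ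
    (PowerSeries.coeff (R := D) i).restrictScalars k

theorem truncEval_apply (ψ : D →ₐ[k] WithConv (C →ₗ[k] k)) (x : WithConv (C →ₗ[k] k)) (n : ℕ)
    (p : PowerSeries D) : truncEval ψ x n p =
      ∑ i ∈ Finset.range (n + 1), ψ (PowerSeries.coeff i p) * x ^ i := by
  simp [truncEval]

theorem truncEval_mul_sub_mem {ψ : D →ₐ[k] WithConv (C →ₗ[k] k)} {x : WithConv (C →ₗ[k] k)}
    (hx : x ∈ loewyAnnihilator k C 0) (hcomm : ∀ d, Commute (ψ d) x) (n : ℕ)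
    (p q : PowerSeries D) :
    truncEval ψ x n p * truncEval ψ x n q - truncEval ψ x n (p * q) ∈ loewyAnnihilator k C n := by
  -- As `x` commutes with the image of `ψ`, evaluation of polynomials is a ring homomorphism. The
  -- product of the truncations and the truncation of the product agree in degrees up to `n`, and `x
  -- ^ (n + 1)` is already in the `n`-th annihilator.
  let ev := Polynomial.eval₂RingHom' ψ.toRingHom x hcomm
  have hev : ∀ p, truncEval ψ x n p = ev (PowerSeries.trunc (n + 1) p) := fun p => by
    rw [truncEval_apply]
    exact (PowerSeries.eval₂_trunc_eq_sum_range x ψ.toRingHom (n + 1) p).symm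
  have hmem : ∀ r : Polynomial D, (∀ i ≤ n, r.coeff i = 0) → ev r ∈ loewyAnnihilator k C n := by
    intro r hr
    change Polynomial.eval₂ ψ.toRingHom x r ∈ _
    rw [Polynomial.eval₂_eq_sum]
    refine Submodule.sum_mem _ fun i _ => ?_
    by_cases hi : i ≤ n
    · simp [hr i hi]
    · obtain ⟨m, rfl⟩ := Nat.exists_eq_succ_of_ne_zero (show i ≠ 0 by omega)
      exact mul_mem_loewyAnnihilator_left n _
        (loewyAnnihilator_anti (by omega) (pow_mem_loewyAnnihilator hx m))
  rw [hev, hev, hev, ← map_mul, ← map_sub]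
  refine hmem _ fun i hi => ?_
  rw [Polynomial.coeff_sub, Polynomial.coeff_mul, PowerSeries.coeff_trunc, if_pos (by omega),
    PowerSeries.coeff_mul, sub_eq_zero]
  refine Finset.sum_congr rfl fun a ha => ?_
  have := Finset.HasAntidiagonal.mem_antidiagonal.1 ha
  rw [PowerSeries.coeff_trunc, PowerSeries.coeff_trunc, if_pos (by omega), if_pos (by omega)]

/-- An algebra homomorphism to the dual algebra, extended to power series by a commuting element
of the annihilator of the socle. -/
theorem exists_powerSeries_hom {ψ : D →ₐ[k] WithConv (C →ₗ[k] k)} {x : WithConv (C →ₗ[k] k)}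
    (hx : x ∈ loewyAnnihilator k C 0) (hcomm : ∀ d, Commute (ψ d) x) :
    ∃ φ : PowerSeries D →ₗ[k] WithConv (C →ₗ[k] k), φ 1 = 1 ∧ (∀ p q, φ (p * q) = φ p * φ q) ∧
      ∀ n p, φ p - truncEval ψ x n p ∈ loewyAnnihilator k C n := by
  obtain ⟨φ, hφ⟩ := exists_limit (truncEval ψ x) fun n p => by
    rw [truncEval_apply, truncEval_apply, Finset.sum_range_succ, add_sub_cancel_left]
    exact mul_mem_loewyAnnihilator_left n _ (pow_mem_loewyAnnihilator hx n)
  refine ⟨φ, ?_, fun p q => ?_, hφ⟩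
  · refine eq_of_sub_mem_loewyAnnihilator fun n => ?_
    have : truncEval ψ x n 1 = 1 := by
      rw [truncEval_apply, Finset.sum_range_succ']
      simp [PowerSeries.coeff_one]
    simpa only [this] using hφ n 1
  · refine eq_of_sub_mem_loewyAnnihilator fun n => ?_
    have h := add_mem (sub_mem (hφ n (p * q)) (truncEval_mul_sub_mem hx hcomm n p q))
      (neg_mem (mul_sub_mul_mem_loewyAnnihilator (hφ n p) (hφ n q)))
    convert h using 1
    abel

end PowerSeriesAction

/-! ### Maps into the finite dual -/

section FiniteDualMap

variable {k : Type*} [Field k] {C : Type*} [AddCommGroup C] [Module k C] [Coalgebra k C]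
  {A : Type*} [Ring A] [Algebra k A]

/-- The series of order at least `n` form a two-sided ideal whose quotient embeds in `D^n`. -/
theorem powerSeries_mem_finiteDual {D : Type*} [Ring D] [Algebra k D] [FiniteDimensional k D]
    (f : PowerSeries D →ₗ[k] k) (n : ℕ)
    (hf : ∀ p, (∀ i < n, PowerSeries.coeff i p = 0) → f p = 0) :
    f ∈ finiteDualSubmodule k (PowerSeries D) := by
  let I : Ideal (PowerSeries D) :=
    { carrier := {p | ∀ i < n, PowerSeries.coeff i p = 0}
      zero_mem' := fun i _ => map_zero _
      add_mem' := fun {p q} hp hq i hi => by rw [map_add, hp i hi, hq i hi, add_zero]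
      smul_mem' := fun q p hp i hi => by
        rw [smul_eq_mul, PowerSeries.coeff_mul]
        refine Finset.sum_eq_zero fun a ha => ?_
        have := Finset.HasAntidiagonal.mem_antidiagonal.1 ha
        rw [hp _ (by omega), mul_zero] }
  refine ⟨I, ⟨fun {p} q hp i hi => ?_⟩, ?_, hf⟩
  · rw [PowerSeries.coeff_mul]
    refine Finset.sum_eq_zero fun a ha => ?_
    have := Finset.HasAntidiagonal.mem_antidiagonal.1 ha
    rw [hp _ (by omega), zero_mul]
  · let g : PowerSeries D →ₗ[k] Fin n → D :=
      LinearMap.pi fun i => (PowerSeries.coeff (R := D) (i : ℕ)).restrictScalars k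
    have hg : I.restrictScalars k = LinearMap.ker g := by
      ext p
      rw [LinearMap.mem_ker, funext_iff]
      exact ⟨fun h i => h i i.2, fun h i hi => h ⟨i, hi⟩⟩
    have : FiniteDimensional k (PowerSeries D ⧸ I.restrictScalars k) := by
      rw [hg]
      exact g.quotKerEquivRange.symm.finiteDimensional
    exact this

/-- A coalgebra that embeds in the finite dual is isomorphic to a subcoalgebra of it. -/
theorem exists_subcoalgebra_equiv (φ : A →ₗ[k] WithConv (C →ₗ[k] k)) (h1 : φ 1 = 1)
    (hmul : ∀ a b, φ (a * b) = φ a * φ b)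
    (hfin : ∀ c : C, ∃ f : FiniteDual k A, ∀ a, FiniteDual.incl k A f a = φ a c)
    (hinj : ∀ c : C, (∀ a, φ a c = 0) → c = 0) :
    ∃ E : Subcoalgebra k (FiniteDual k A), Nonempty (C ≃ₗc[k] E) := by
  choose Φ₀ hΦ₀ using hfin
  -- `Φ` is the transpose of `φ`: multiplicativity of `φ` becomes compatibility with `Δ`, and `φ 1 =
  -- 1` compatibility with the counits.
  let Φ : C →ₗ[k] FiniteDual k A :=
    { toFun := Φ₀
      map_add' := fun c d => Subtype.ext <| LinearMap.ext fun a => by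
        change FiniteDual.incl k A (Φ₀ (c + d)) a =
          FiniteDual.incl k A (Φ₀ c) a + FiniteDual.incl k A (Φ₀ d) a
        rw [hΦ₀, hΦ₀, hΦ₀, map_add]
      map_smul' := fun r c => Subtype.ext <| LinearMap.ext fun a => by
        change FiniteDual.incl k A (Φ₀ (r • c)) a = r • FiniteDual.incl k A (Φ₀ c) a
        rw [hΦ₀, hΦ₀, map_smul] }
  have hΦ : ∀ c a, FiniteDual.incl k A (Φ c) a = φ a c := hΦ₀
  have hΦinj : Function.Injective Φ := by
    rw [injective_iff_map_eq_zero]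
    intro c hc
    refine hinj c fun a => ?_
    rw [← hΦ, hc, map_zero, LinearMap.zero_apply]
  have hcomul : ∀ c, Coalgebra.comul (R := k) (Φ c) =
      TensorProduct.map Φ Φ (Coalgebra.comul (R := k) c) := by
    intro c
    apply finiteDualPairing_injective
    ext a b
    change finiteDualPairing k A (finiteDualComul (Φ c)) (a ⊗ₜ b) =
      finiteDualPairing k A (TensorProduct.map Φ Φ (Coalgebra.comul (R := k) c)) (a ⊗ₜ b)
    rw [finiteDualPairing_comul, hΦ, hmul, LinearMap.convMul_apply]
    generalize Coalgebra.comul (R := k) c = t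
    induction t with
    | zero => simp
    | tmul x y => simp [finiteDualPairing, hΦ]
    | add s t hs ht => simp only [map_add, LinearMap.add_apply, hs, ht]
  obtain ⟨E, hE⟩ : ∃ E : Subcoalgebra k (FiniteDual k A), E.carrier = LinearMap.range Φ := by
    refine ⟨⟨LinearMap.range Φ, ?_⟩, rfl⟩
    rintro _ ⟨c, rfl⟩
    refine ⟨TensorProduct.map Φ.rangeRestrict Φ.rangeRestrict (Coalgebra.comul (R := k) c), ?_⟩
    rw [hcomul, ← LinearMap.comp_apply, ← TensorProduct.map_comp]
    rfl
  let ε : C ≃ₗ[k] E := (LinearEquiv.ofInjective Φ hΦinj).trans (LinearEquiv.ofEq _ _ hE.symm)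
  have hε : E.carrier.subtype ∘ₗ ε.toLinearMap = Φ := rfl
  refine ⟨E, ⟨{ ε with counit_comp := ?_, map_comp_comul := ?_ }⟩⟩
  · ext c
    change FiniteDual.incl k A (Φ c) 1 = _
    rw [hΦ, h1, LinearMap.convOne_apply]
    rfl
  · ext c
    apply E.map_subtype_injective
    refine Eq.trans ?_ (E.map_comul (ε c)).symm
    refine Eq.trans ?_ (hcomul c).symm
    change TensorProduct.map E.carrier.subtype E.carrier.subtype
      (TensorProduct.map ε.toLinearMap ε.toLinearMap (Coalgebra.comul (R := k) c)) = _
    rw [← LinearMap.comp_apply, ← TensorProduct.map_comp, hε]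

end FiniteDualMap

end ChainCoalg

/-! ### The embedding into the finite dual of the power series algebra -/

theorem mainTheorem9 {k : Type*} [Field k] {D : Type*} [DivisionRing D] [Algebra k D]
    [FiniteDimensional k D] [Algebra.IsCentral k D]
    {C : Type*} [AddCommGroup C] [Module k C] [Coalgebra k C]
    (hC : ChainCoalg.IsChainCoalgebraOfType k C D) :
    ∃ E : ChainCoalg.Subcoalgebra k (ChainCoalg.FiniteDual k (PowerSeries D)),
      Nonempty (C ≃ₗc[k] E) := by
  open ChainCoalg in
  obtain ⟨hchain, ⟨e⟩⟩ := hC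
  obtain ⟨ψ, hψ⟩ := exists_algHom_lift e.toAlgHom
  obtain ⟨x, hx, hcomm, hker⟩ := exists_uniformizer hchain ψ
  obtain ⟨φ, h1, hmul, hφ⟩ := exists_powerSeries_hom hx hcomm
  have hφ' : ∀ n p, ∀ c ∈ loewy k C n, φ p c = truncEval ψ x n p c :=
    fun n p c hc => sub_eq_zero.1 (hφ n p c hc)
  refine exists_subcoalgebra_equiv φ h1 hmul (fun c => ?_) fun c hc => ?_
  · obtain ⟨n, hn⟩ := exists_mem_loewy (k := k) c
    refine ⟨⟨(Module.Dual.eval k C c) ∘ₗ (WithConv.linearEquiv k (C →ₗ[k] k)).toLinearMap ∘ₗ φ,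
      powerSeries_mem_finiteDual _ (n + 1) fun p hp => ?_⟩, fun a => rfl⟩
    change φ p c = 0
    rw [hφ' n p c hn, truncEval_apply, Finset.sum_eq_zero]
    · rfl
    · intro i hi
      rw [hp i (Finset.mem_range.1 hi), map_zero, zero_mul]
  · by_contra hc0
    obtain ⟨n, hn⟩ := exists_mem_loewy (k := k) c
    -- Functionals vanishing on the socle act locally nilpotently, so there is a first power of `x`
    -- that kills `c`; `i` is the exponent just before it.
    have hnil : rightHit (x ^ (n + 1)).ofConv c = 0 := eq_of_forall_conv (k := k) fun h => by
      rw [← conv_mul_apply_rightHit, map_zero]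
      exact mul_mem_loewyAnnihilator_right n h (pow_mem_loewyAnnihilator hx n) c hn
    have hex : ∃ i, rightHit (x ^ i).ofConv c = 0 := ⟨_, hnil⟩
    classical
    obtain ⟨i, hi⟩ : ∃ i, Nat.find hex = i + 1 := Nat.exists_eq_succ_of_ne_zero fun h => hc0 <| by
      have := Nat.find_spec hex
      rwa [h, pow_zero, rightHit_one] at this
    have hin : i < n + 1 := by
      have := Nat.find_min' hex hnil
      omega
    have hi0 : rightHit (x ^ i).ofConv c ≠ 0 := Nat.find_min hex (by omega)
    have hi1 : rightHit (x ^ (i + 1)).ofConv c = 0 := hi ▸ Nat.find_spec hex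
    rw [pow_succ, rightHit_mul] at hi1
    have hsoc := hker _ hi1
    apply hi0
    refine congrArg Subtype.val (eq_of_forall_conv (k := k)
      (x := (⟨_, hsoc⟩ : coradical k C)) (y := 0) fun h => ?_)
    -- Every functional on the coradical comes from some `d`, and its value at `c ↼ x^i` is `(ψ d *
    -- x^i) c`, which is the value of `φ` at `d X^i` on `c` because `i ≤ n`. The hypothesis `hc`
    -- makes it zero.
    obtain ⟨d, rfl⟩ := e.surjective h
    rw [map_zero]
    refine (hψ d ⟨_, hsoc⟩).symm.trans ?_
    rw [← conv_mul_apply_rightHit, ← (hcomm d).pow_right i]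
    have := hc (PowerSeries.monomial i d)
    rw [hφ' n _ c hn, truncEval_apply, Finset.sum_eq_single i] at this
    · simpa using this
    · intro j _ hj
      rw [PowerSeries.coeff_monomial, if_neg hj, map_zero, zero_mul]
    · intro h
      exact absurd (Finset.mem_range.2 hin) h
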